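/- Let $d\in\mathbb{N}$, let $\mu_0,\mu_1$ be Borel probability measures on $\mathbb{R}^d$ with compact supports, let $K\subset\mathbb{R}^d$ be compact, and let $\mathcal{P}(K)$ be the set of Borel probability measures on $\mathbb{R}^d$ whose support is contained in $K$. For a cost $c:\mathbb{R}^d\times\mathbb{R}^d\to[0,\infty)$ and Borel probability measures $\rho_0,\rho_1$ on $\mathbb{R}^d$, let $$W_c(\rho_0,\rho_1)=\inf_{\gamma\in\Pi(\rho_0,\rho_1)}\int_{\mathbb{R}^d\times\mathbb{R}^d} c\,d\gamma,$$ where $\Pi(\rho_0,\rho_1)$ is the set of Borel probability measures on $\mathbb{R}^d\times\mathbb{R}^d$ with first marginal $\rho_0$ and second marginal $\rho_1$. Let $\lambda>0$, $\alpha\in(0,1]$, and consider the distance-like costs $$c_0(x_0,x)=|x_0-x|^\alpha,\qquad c_1(x,x_1)=\lambda|x-x_1|^\alpha,$$ where $|\cdot|$ is the Euclidean norm. Assume that one of the following holds: - $\alpha=1$, $\lambda>1$, and the interior of $K$ is disjoint from $\operatorname{spt}\mu_1$; - $\alpha\in(0,1)$ and the interior of $K$ is disjoint from $\operatorname{spt}\mu_0\cup\operatorname{spt}\mu_1$.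 Then every solution $\mu$ of $$\inf\{W_{c_0}(\mu_0,\mu)+W_{c_1}(\mu,\mu_1)\ :\ \mu\in\mathcal{P}(K)\}$$ is supported by the boundary of $K$, that is, $\operatorname{spt}\mu\subset\partial K$. -/

import Mathlib

open MeasureTheory Set
open scoped ENNReal

noncomputable section

/-- The Euclidean space `ℝᵈ`. -/
abbrev Euc (d : ℕ) : Type := EuclideanSpace ℝ (Fin d)

/-- The set `Π(ρ₀, ρ₁)` of transport plans: Borel probability measures on `ℝᵈ × ℝᵈ` with
marginals `ρ₀` and `ρ₁`. -/
def transportPlans {d : ℕ} (ρ₀ ρ₁ : Measure (Euc d)) : Set (Measure (Euc d × Euc d)) :=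
  {γ | IsProbabilityMeasure γ ∧ γ.map Prod.fst = ρ₀ ∧ γ.map Prod.snd = ρ₁}

/-- The optimal transport value `W_c(ρ₀, ρ₁) = inf {∫ c dγ : γ ∈ Π(ρ₀, ρ₁)}` of a nonnegative
cost `c`, with values in `[0, ∞]`. -/
def transportCost {d : ℕ} (c : Euc d → Euc d → ℝ) (ρ₀ ρ₁ : Measure (Euc d)) : ℝ≥0∞ :=
  ⨅ γ ∈ transportPlans ρ₀ ρ₁, ∫⁻ p, ENNReal.ofReal (c p.1 p.2) ∂γ

/-- The class `𝒫(K)` of Borel probability measures on `ℝᵈ` whose support is contained in `K`. -/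
def probOn {d : ℕ} (K : Set (Euc d)) : Set (Measure (Euc d)) :=
  {μ | IsProbabilityMeasure μ ∧ μ.support ⊆ K}

/-- `μ` is a solution of `inf {W_{c₀}(μ₀, μ) + W_{c₁}(μ, μ₁) : μ ∈ A}`. -/
def IsOptimalPivot {d : ℕ} (c₀ c₁ : Euc d → Euc d → ℝ) (μ₀ μ₁ : Measure (Euc d))
    (A : Set (Measure (Euc d))) (μ : Measure (Euc d)) : Prop :=
  μ ∈ A ∧ ∀ ν ∈ A, transportCost c₀ μ₀ μ + transportCost c₁ μ μ₁ ≤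
    transportCost c₀ μ₀ ν + transportCost c₁ ν μ₁

/-- The distance-like cost `(x, y) ↦ κ |x - y|^α`, with `|·|` the Euclidean norm. -/
def distCost {d : ℕ} (κ α : ℝ) (x y : Euc d) : ℝ := κ * ‖x - y‖ ^ α

end

open Filter Topology ProbabilityTheory

/-! For fixed endpoints x₀, x₁, the cost y ↦ c₀(x₀, y) + c₁(y, x₁) has no local minimum in the
interior of K. For α = 1, moving towards x₁ saves λ > 1 per unit length and costs at most 1. For α <
1, either the gradient is nonzero, or x lies between x₀ and x₁ and the cost is strictly concave
along that line near x.

Hence interior mass is never optimal. If a closed ball inside the interior of K had positive μ-mass,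
nearly optimal plans could be glued into a law of triples (x₀, x, x₁) (`exists_gluing`). A
measurable displacement of the middle point that gains a uniform δ whenever x is in the ball
(`exists_measurable_improvement`) would then yield a measure on K strictly better than μ. -/

/-! ### Absence of local minima for fixed endpoints -/

/-- The sum of the distance to `x₀` and of a multiple, larger than one, of the distance to `x₁`
has no local minimum away from `x₁`. -/
theorem not_isLocalMin_dist_add_mul_dist {E : Type*} [NormedAddCommGroup E] [NormedSpace ℝ E]
    {lam : ℝ} (hlam : 1 < lam) {x₀ x x₁ : E} (hx : x ≠ x₁) :
    ¬ IsLocalMin (fun y => ‖x₀ - y‖ + lam * ‖y - x₁‖) x := by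
  intro h
  have hv : 0 < ‖x - x₁‖ := norm_pos_iff.2 (sub_ne_zero.2 hx)
  have ht : Tendsto (fun t : ℝ => x + t • (x₁ - x)) (𝓝[>] 0) (𝓝 x) := by
    have : Continuous (fun t : ℝ => x + t • (x₁ - x)) := by fun_prop
    simpa using (this.tendsto 0).mono_left nhdsWithin_le_nhds
  have h1 : ∀ᶠ t : ℝ in 𝓝[>] 0, t < 1 := nhdsWithin_le_nhds (eventually_lt_nhds one_pos)
  obtain ⟨t, hmin, ht1, ht0⟩ :=
    ((ht.eventually h).and (h1.and self_mem_nhdsWithin)).exists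
  have ht0 : 0 < t := ht0
  have e1 : ‖x₀ - (x + t • (x₁ - x))‖ ≤ ‖x₀ - x‖ + t * ‖x - x₁‖ := by
    have : x₀ - (x + t • (x₁ - x)) = (x₀ - x) + t • (x - x₁) := by module
    rw [this]
    refine (norm_add_le _ _).trans_eq ?_
    rw [norm_smul, Real.norm_of_nonneg ht0.le]
  have e2 : ‖x + t • (x₁ - x) - x₁‖ = (1 - t) * ‖x - x₁‖ := by
    have : x + t • (x₁ - x) - x₁ = (1 - t) • (x - x₁) := by module
    rw [this, norm_smul, Real.norm_of_nonneg (by linarith)]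
  simp only [e2] at hmin
  have : 0 < t * ‖x - x₁‖ * (lam - 1) := by have := sub_pos.2 hlam; positivity
  nlinarith

/-- A quadratic upper bound for a power of the norm with exponent in `(0, 1)`. -/
theorem norm_add_rpow_le {E : Type*} [NormedAddCommGroup E] [InnerProductSpace ℝ E]
    {α : ℝ} (h0 : 0 < α) (h1 : α < 1) {u : E} (hu : u ≠ 0) (w : E) :
    ‖u + w‖ ^ α ≤ ‖u‖ ^ α + α / 2 * (‖u‖ ^ α / ‖u‖ ^ 2) * (2 * inner ℝ u w + ‖w‖ ^ 2) := by
  have hn : 0 < ‖u‖ := norm_pos_iff.2 hu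
  -- `s` is the relative change of the squared norm, so Bernoulli's inequality applies with exponent
  -- α/2.
  set s : ℝ := (2 * inner ℝ u w + ‖w‖ ^ 2) / ‖u‖ ^ 2 with hs
  have e : ‖u + w‖ ^ 2 = ‖u‖ ^ 2 * (1 + s) := by
    rw [norm_add_sq_real, hs]; field_simp; ring
  have hs1 : 0 ≤ 1 + s := by
    by_contra hc
    nlinarith [sq_nonneg ‖u + w‖, pow_pos hn 2]
  have e2 : ‖u + w‖ ^ α = ‖u‖ ^ α * (1 + s) ^ (α / 2) := by
    have key : ∀ r : ℝ, 0 ≤ r → r ^ α = (r ^ 2) ^ (α / 2) := fun r hr => by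
      rw [← Real.rpow_natCast r 2, ← Real.rpow_mul hr]; congr 1; push_cast; ring
    rw [key _ (norm_nonneg _), e, Real.mul_rpow (by positivity) hs1, ← key _ hn.le]
  have hb := rpow_one_add_le_one_add_mul_self (s := s) (p := α / 2) (by linarith)
    (by linarith) (by linarith)
  calc ‖u + w‖ ^ α ≤ ‖u‖ ^ α * (1 + α / 2 * s) := by rw [e2]; gcongr
    _ = _ := by rw [hs]; ring

/-- A weighted sum of two powers of distances, with exponent in `(0, 1)`, has no local minimum
away from the two base points. -/
theorem not_isLocalMin_rpow_dist_add_mul_rpow_dist {E : Type*} [NormedAddCommGroup E]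
    [InnerProductSpace ℝ E] {lam α : ℝ} (hlam : 0 < lam) (h0 : 0 < α) (h1 : α < 1) {x₀ x x₁ : E}
    (hx₀ : x ≠ x₀) (hx₁ : x ≠ x₁) :
    ¬ IsLocalMin (fun y => ‖x₀ - y‖ ^ α + lam * ‖y - x₁‖ ^ α) x := by
  intro h
  obtain ⟨u, rfl⟩ : ∃ u, x₀ = x - u := ⟨x - x₀, by abel⟩
  obtain ⟨v, rfl⟩ : ∃ v, x₁ = x - v := ⟨x - x₁, by abel⟩
  have hu : u ≠ 0 := by rintro rfl; simp at hx₀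
  have hv : v ≠ 0 := by rintro rfl; simp at hx₁
  have hun : 0 < ‖u‖ := norm_pos_iff.2 hu
  have hvn : 0 < ‖v‖ := norm_pos_iff.2 hv
  have hline (w : E) : ∀ᶠ t : ℝ in 𝓝 0,
      ‖u‖ ^ α + lam * ‖v‖ ^ α ≤ ‖u + t • w‖ ^ α + lam * ‖v + t • w‖ ^ α := by
    have ht : Tendsto (fun t : ℝ => x + t • w) (𝓝 0) (𝓝 x) := by
      have : Continuous (fun t : ℝ => x + t • w) := by fun_prop
      simpa using this.tendsto 0
    filter_upwards [ht.eventually h] with t hmin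
    have a1 : ‖x - u - (x + t • w)‖ = ‖u + t • w‖ := by rw [← norm_neg]; congr 1; abel
    have a2 : x + t • w - (x - v) = v + t • w := by abel
    simpa [a1, a2] using hmin
  set A : ℝ := α / 2 * (‖u‖ ^ α / ‖u‖ ^ 2) with hA
  set B : ℝ := lam * (α / 2 * (‖v‖ ^ α / ‖v‖ ^ 2)) with hB
  have hA0 : 0 < A := by positivity
  have hB0 : 0 < B := by positivity
  -- `A • u + B • v` is half the gradient at `x`. If it vanishes, `x` lies on the segment from `x₀`
  -- to `x₁`.
  by_cases hg : A • u + B • v = 0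
  · have hvu : v = (-(A / B)) • u := by
      have : B • v = -(A • u) := by rw [eq_neg_iff_add_eq_zero, add_comm]; exact hg
      rw [← inv_smul_smul₀ hB0.ne' v, this, neg_smul, smul_neg, smul_smul, div_eq_inv_mul]
    set k := A / B with hk
    have hk0 : 0 < k := by positivity
    have hev : ∀ᶠ t : ℝ in 𝓝[≠] 0, |t| < min 1 k := by
      apply nhdsWithin_le_nhds
      have : Tendsto (fun t : ℝ => |t|) (𝓝 0) (𝓝 0) := by
        simpa using (continuous_abs (G := ℝ)).tendsto 0
      exact this.eventually_lt_const (by positivity)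
    have hneg : Tendsto (fun t : ℝ => -t) (𝓝 0) (𝓝 0) := by
      simpa using (continuous_neg (G := ℝ)).tendsto 0
    obtain ⟨t, hp, hm, htk, ht0⟩ := ((eventually_nhdsWithin_of_eventually_nhds (hline u)).and
      ((eventually_nhdsWithin_of_eventually_nhds (hneg.eventually (hline u))).and
        (hev.and self_mem_nhdsWithin))).exists
    have ht0 : t ≠ 0 := ht0
    -- Strict Bernoulli for both terms. The linear part is odd in `s`, so adding the bounds at `t`
    -- and `-t` cancels it and contradicts minimality at both points.
    have key : ∀ s : ℝ, s ≠ 0 → |s| < min 1 k → ‖u + s • u‖ ^ α + lam * ‖v + s • u‖ ^ α <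
        ‖u‖ ^ α + lam * ‖v‖ ^ α + s * (α * ‖u‖ ^ α - lam * α * ‖v‖ ^ α / k) := by
      intro s hs hsk
      obtain ⟨hs1, hsk⟩ := lt_min_iff.1 hsk
      have hs1' := abs_lt.1 hs1
      have hsk' : |-(s / k)| < 1 := by
        rw [abs_neg, abs_div, abs_of_pos hk0, div_lt_one hk0]; exact hsk
      have hsk'' := abs_lt.1 hsk'
      have n1 : ‖u + s • u‖ = (1 + s) * ‖u‖ := by
        have : u + s • u = (1 + s) • u := by module
        rw [this, norm_smul, Real.norm_of_nonneg (by linarith)]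
      have n2 : ‖v + s • u‖ = (1 + -(s / k)) * ‖v‖ := by
        have : v + s • u = (1 + -(s / k)) • v := by
          have : s • u = (-(s / k)) • v := by
            rw [hvu, smul_smul]; congr 1; field_simp
          rw [this]; module
        rw [this, norm_smul, Real.norm_of_nonneg (by linarith)]
      rw [n1, n2, Real.mul_rpow (by linarith) hun.le, Real.mul_rpow (by linarith) hvn.le]
      have b1 := rpow_one_add_lt_one_add_mul_self hs1'.1.le hs h0 h1
      have b2 := rpow_one_add_lt_one_add_mul_self hsk''.1.le
        (neg_ne_zero.2 (div_ne_zero hs hk0.ne')) h0 h1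
      have hup : 0 < ‖u‖ ^ α := by positivity
      have hvp : 0 < lam * ‖v‖ ^ α := by positivity
      have c1 := mul_lt_mul_of_pos_right b1 hup
      have c2 := mul_lt_mul_of_pos_right b2 hvp
      calc _ = (1 + s) ^ α * ‖u‖ ^ α + (1 + -(s / k)) ^ α * (lam * ‖v‖ ^ α) := by ring
        _ < _ := add_lt_add c1 c2
        _ = _ := by ring
    have kp := key t ht0 htk
    have km := key (-t) (neg_ne_zero.2 ht0) (by rwa [abs_neg])
    linarith
  -- Descent along `-g`: the quadratic bounds add up to `t * ‖g‖ ^ 2 * (t * (A + B) - 2)`, negative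
  -- for `t < 1 / (A + B)`.
  · set g := A • u + B • v with hgdef
    have hgn : 0 < ‖g‖ := norm_pos_iff.2 hg
    have hev : ∀ᶠ t : ℝ in 𝓝[>] 0, t < 1 / (A + B) :=
      nhdsWithin_le_nhds (eventually_lt_nhds (by positivity))
    obtain ⟨t, hmin, htk, ht0⟩ := ((eventually_nhdsWithin_of_eventually_nhds (hline (-g))).and
        (hev.and self_mem_nhdsWithin)).exists
    have ht0 : 0 < t := ht0
    rw [lt_div_iff₀ (by positivity)] at htk
    have b1 := norm_add_rpow_le h0 h1 hu (t • (-g))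
    have b2 := mul_le_mul_of_nonneg_left (norm_add_rpow_le h0 h1 hv (t • (-g))) hlam.le
    have hin : A * inner ℝ u g + B * inner ℝ v g = ‖g‖ ^ 2 := by
      rw [← real_inner_self_eq_norm_sq, ← real_inner_smul_left, ← real_inner_smul_left,
        ← inner_add_left]
    have hnt : ‖t • (-g)‖ ^ 2 = t ^ 2 * ‖g‖ ^ 2 := by
      rw [norm_smul, norm_neg, mul_pow, Real.norm_eq_abs, sq_abs]
    rw [hnt, real_inner_smul_right, inner_neg_right] at b1 b2
    rw [← hA] at b1
    have b3 : lam * ‖v + t • -g‖ ^ α ≤ lam * ‖v‖ ^ α +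
        B * (2 * (t * -inner ℝ v g) + t ^ 2 * ‖g‖ ^ 2) := by rw [hB]; linarith
    have hfin : 0 ≤ t * ‖g‖ ^ 2 * (t * (A + B) - 2) := by
      have : A * (2 * (t * -inner ℝ u g) + t ^ 2 * ‖g‖ ^ 2) +
          B * (2 * (t * -inner ℝ v g) + t ^ 2 * ‖g‖ ^ 2) =
          t * ‖g‖ ^ 2 * (t * (A + B) - 2) := by
        linear_combination (-2 * t) * hin
      linarith
    have hp : 0 < t * ‖g‖ ^ 2 := by positivity
    nlinarith

/-! ### Gluing and measurable selection -/

/-- Gluing of two transport plans along their common marginal. -/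
theorem exists_gluing {X Y Z : Type*} [MeasurableSpace X] [MeasurableSpace Y] [MeasurableSpace Z]
    [StandardBorelSpace Z] [Nonempty Z] (γ₀ : Measure (X × Y)) (γ₁ : Measure (Y × Z))
    [IsProbabilityMeasure γ₀] [IsProbabilityMeasure γ₁] (h : γ₀.map Prod.snd = γ₁.map Prod.fst) :
    ∃ π : Measure ((X × Y) × Z), IsProbabilityMeasure π ∧ π.map Prod.fst = γ₀ ∧
      π.map (fun p => (p.1.2, p.2)) = γ₁ := by
  -- Given `(x, y)`, draw `z` from the conditional law of `γ₁` given `y`, independently of `x`.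
  refine ⟨γ₀ ⊗ₘ (γ₁.condKernel.comap Prod.snd measurable_snd), inferInstance,
    Measure.fst_compProd _ _, ?_⟩
  refine Measure.ext_of_lintegral _ fun f hf => ?_
  rw [lintegral_map hf (by fun_prop), Measure.lintegral_compProd (by fun_prop)]
  simp only [Kernel.lintegral_comap]
  rw [← lintegral_map (f := fun y => ∫⁻ z, f (y, z) ∂γ₁.condKernel y) (g := Prod.snd)
    hf.lintegral_kernel_prod_right' measurable_snd, h]
  conv_rhs => rw [← γ₁.disintegrate γ₁.condKernel, Measure.lintegral_compProd hf]
  rfl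

/-- If every point of a compact set `C` can be strictly improved by a point of `K`, then there is
a measurable choice of improvements with a uniform gain. -/
theorem exists_measurable_improvement {P Y : Type*} [TopologicalSpace P] [MeasurableSpace P]
    [OpensMeasurableSpace P] [MeasurableSpace Y] {C : Set P} (hC : IsCompact C) {K : Set Y}
    {F : P → Y → ℝ} {G : P → ℝ} (hF : ∀ y, Continuous fun p => F p y) (hG : Continuous G)
    (himp : ∀ p ∈ C, ∃ y ∈ K, F p y < G p) {T₀ : P → Y} (hT₀ : Measurable T₀) :
    ∃ (M : Set P) (T : P → Y) (δ : ℝ), C ⊆ M ∧ 0 < δ ∧ Measurable T ∧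
      (∀ p ∈ M, T p ∈ K ∧ F p (T p) + δ ≤ G p) ∧ ∀ p ∉ M, T p = T₀ p := by
  classical
  suffices H : ∃ (M : Set P) (T : P → Y) (δ : ℝ), C ⊆ M ∧ MeasurableSet M ∧ 0 < δ ∧
      Measurable T ∧ ∀ p ∈ M, T p ∈ K ∧ F p (T p) + δ ≤ G p by
    obtain ⟨M, T, δ, hCM, hM, hδ, hT, hg⟩ := H
    refine ⟨M, M.piecewise T T₀, δ, hCM, hδ, hT.piecewise hM hT₀, fun p hp => ?_, fun p hp => ?_⟩
    · simpa [hp] using hg p hp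
    · simp [hp]
  -- Compactness reduces to finitely many patches, so the smallest gain stays positive.
  refine hC.induction_on (p := fun C => ∃ (M : Set P) (T : P → Y) (δ : ℝ), C ⊆ M ∧
    MeasurableSet M ∧ 0 < δ ∧ Measurable T ∧ ∀ p ∈ M, T p ∈ K ∧ F p (T p) + δ ≤ G p)
    ⟨∅, T₀, 1, by simp, by simp, one_pos, hT₀, by simp⟩ ?_ ?_ ?_
  · rintro s t hst ⟨M, T, δ, hM, h⟩
    exact ⟨M, T, δ, hst.trans hM, h⟩
  · rintro s t ⟨M, T, δ, hsM, hM, hδ, hT, h⟩ ⟨M', T', δ', htM, hM', hδ', hT', h'⟩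
    refine ⟨M ∪ M', M.piecewise T T', min δ δ', union_subset_union hsM htM, hM.union hM',
      lt_min hδ hδ', hT.piecewise hM hT', fun p hp => ?_⟩
    by_cases hpM : p ∈ M
    · obtain ⟨h1, h2⟩ := h p hpM
      simp only [hpM, piecewise_eq_of_mem]
      exact ⟨h1, by linarith [min_le_left δ δ']⟩
    · obtain ⟨h1, h2⟩ := h' p (hp.resolve_left hpM)
      simp only [hpM, not_false_eq_true, piecewise_eq_of_notMem]
      exact ⟨h1, by linarith [min_le_right δ δ']⟩
  · intro p hp
    obtain ⟨y, hy, hlt⟩ := himp p hp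
    -- By continuity, the constant choice `y` keeps half of its gain at `p` on a neighbourhood.
    have hO : IsOpen {q | F q y + (G p - F p y) / 2 < G q} :=
      isOpen_lt ((hF y).add continuous_const) hG
    refine ⟨_, mem_nhdsWithin_of_mem_nhds (hO.mem_nhds ?_), {q | F q y + (G p - F p y) / 2 < G q},
      fun _ => y, (G p - F p y) / 2, Subset.rfl, hO.measurableSet, by linarith, measurable_const,
      fun q hq => ⟨hy, le_of_lt hq⟩⟩
    show F p y + (G p - F p y) / 2 < G p
    linarith

/-! ### Transport costs and the competitor measure -/

/-- A transport problem with continuous cost between compactly supported probability measures has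
finite value. -/
theorem transportCost_ne_top {d : ℕ} {c : Euc d → Euc d → ℝ} (hc : Continuous (Function.uncurry c))
    {ρ₀ ρ₁ : Measure (Euc d)} [IsProbabilityMeasure ρ₀] [IsProbabilityMeasure ρ₁]
    (h₀ : IsCompact ρ₀.support) (h₁ : IsCompact ρ₁.support) : transportCost c ρ₀ ρ₁ ≠ ⊤ := by
  obtain ⟨b, hb⟩ := ((h₀.prod h₁).image hc).bddAbove
  have hmem : ρ₀.prod ρ₁ ∈ transportPlans ρ₀ ρ₁ :=
    ⟨inferInstance, by simp [Measure.map_fst_prod], by simp [Measure.map_snd_prod]⟩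
  refine ne_top_of_le_ne_top (b := ENNReal.ofReal b) ENNReal.ofReal_ne_top
    ((iInf₂_le _ hmem).trans ?_)
  have hae : ∀ᵐ p ∂ρ₀.prod ρ₁, ENNReal.ofReal (c p.1 p.2) ≤ ENNReal.ofReal b := by
    filter_upwards [Measure.quasiMeasurePreserving_fst.ae Measure.support_mem_ae,
      Measure.quasiMeasurePreserving_snd.ae Measure.support_mem_ae] with p h1 h2
    exact ENNReal.ofReal_le_ofReal (hb ⟨p, ⟨h1, h2⟩, rfl⟩)
  exact (lintegral_mono_ae hae).trans (by simp)

/-- The transport cost between the laws of two random vectors is at most their expected cost. -/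
theorem transportCost_map_le {d : ℕ} {Ω : Type*} [MeasurableSpace Ω] (π : Measure Ω)
    [IsProbabilityMeasure π] {c : Euc d → Euc d → ℝ} (hc : Continuous (Function.uncurry c))
    {f g : Ω → Euc d} (hf : Measurable f) (hg : Measurable g) :
    transportCost c (π.map f) (π.map g) ≤ ∫⁻ ω, ENNReal.ofReal (c (f ω) (g ω)) ∂π := by
  have hfg : Measurable fun ω => (f ω, g ω) := hf.prodMk hg
  have hmem : π.map (fun ω => (f ω, g ω)) ∈ transportPlans (π.map f) (π.map g) :=
    ⟨Measure.isProbabilityMeasure_map hfg.aemeasurable,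
      by rw [Measure.map_map measurable_fst hfg]; rfl,
      by rw [Measure.map_map measurable_snd hfg]; rfl⟩
  refine (iInf₂_le _ hmem).trans_eq ?_
  exact lintegral_map (hc.measurable.ennreal_ofReal) hfg

/-- If the sum of two continuous costs can always be strictly improved when the intermediate point
lies in the interior of `K`, then optimal intermediate measures are supported by the boundary. -/
theorem IsOptimalPivot.support_subset_frontier {d : ℕ} {c₀ c₁ : Euc d → Euc d → ℝ}
    (hc₀ : Continuous (Function.uncurry c₀)) (hc₁ : Continuous (Function.uncurry c₁))
    (hp₀ : ∀ x y, 0 ≤ c₀ x y) (hp₁ : ∀ x y, 0 ≤ c₁ x y) {μ₀ μ₁ μ : Measure (Euc d)}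
    [IsProbabilityMeasure μ₀] [IsProbabilityMeasure μ₁]
    (hμ₀ : IsCompact μ₀.support) (hμ₁ : IsCompact μ₁.support) {K : Set (Euc d)} (hK : IsCompact K)
    (himp : ∀ x₀ ∈ μ₀.support, ∀ x ∈ interior K, ∀ x₁ ∈ μ₁.support,
      ∃ y ∈ K, c₀ x₀ y + c₁ y x₁ < c₀ x₀ x + c₁ x x₁)
    (hμ : IsOptimalPivot c₀ c₁ μ₀ μ₁ (probOn K) μ) : μ.support ⊆ frontier K := by
  obtain ⟨⟨hμP, hμK⟩, hopt⟩ := hμ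
  intro z hz
  rw [hK.isClosed.frontier_eq]
  refine ⟨hμK hz, fun hzi => ?_⟩
  obtain ⟨r, hr, hrK⟩ := Metric.nhds_basis_closedBall.mem_iff.1 (isOpen_interior.mem_nhds hzi)
  have hm : 0 < μ (Metric.closedBall z r) :=
    Measure.mem_support_iff_forall z |>.1 hz _ (Metric.closedBall_mem_nhds z hr)
  set G : (Euc d × Euc d) × Euc d → ℝ := fun p => c₀ p.1.1 p.1.2 + c₁ p.1.2 p.2 with hG
  set F : (Euc d × Euc d) × Euc d → Euc d → ℝ := fun p y => c₀ p.1.1 y + c₁ y p.2 with hF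
  obtain ⟨M, T, δ, hCM, hδ, hT, hgain, hrest⟩ := exists_measurable_improvement
    (C := (μ₀.support ×ˢ Metric.closedBall z r) ×ˢ μ₁.support) (K := K) (F := F) (G := G)
    ((hμ₀.prod (isCompact_closedBall z r)).prod hμ₁)
    (fun y => (hc₀.comp (f := fun p : (Euc d × Euc d) × Euc d => (p.1.1, y)) (by fun_prop)).add
      (hc₁.comp (f := fun p : (Euc d × Euc d) × Euc d => (y, p.2)) (by fun_prop)))
    ((hc₀.comp (f := fun p : (Euc d × Euc d) × Euc d => p.1) (by fun_prop)).add
      (hc₁.comp (f := fun p : (Euc d × Euc d) × Euc d => (p.1.2, p.2)) (by fun_prop)))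
    (fun p hp => himp _ hp.1.1 _ (hrK hp.1.2) _ hp.2)
    (T₀ := fun p => p.1.2) (by fun_prop)
  have hμc : IsCompact μ.support := hK.of_isClosed_subset Measure.isClosed_support hμK
  have hfin₀ := transportCost_ne_top hc₀ hμ₀ hμc
  have hfin₁ := transportCost_ne_top hc₁ hμc hμ₁
  -- `η` is the guaranteed gain. Each plan may be suboptimal by less than `η / 2`, so no optimal
  -- plan is needed; finite costs make this slack strict.
  set η : ℝ≥0∞ := ENNReal.ofReal δ * μ (Metric.closedBall z r) with hη
  have hη0 : η / 2 ≠ 0 := by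
    simp [hη, hδ, hm.ne']
  obtain ⟨γ₀, hγ₀, hlt₀⟩ : ∃ γ ∈ transportPlans μ₀ μ, ∫⁻ p, ENNReal.ofReal (c₀ p.1 p.2) ∂γ <
      transportCost c₀ μ₀ μ + η / 2 := by
    simpa [transportCost, iInf_lt_iff] using ENNReal.lt_add_right hfin₀ hη0
  obtain ⟨γ₁, hγ₁, hlt₁⟩ : ∃ γ ∈ transportPlans μ μ₁, ∫⁻ p, ENNReal.ofReal (c₁ p.1 p.2) ∂γ <
      transportCost c₁ μ μ₁ + η / 2 := by
    simpa [transportCost, iInf_lt_iff] using ENNReal.lt_add_right hfin₁ hη0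
  obtain ⟨hγ₀P, hγ₀1, hγ₀2⟩ := hγ₀
  obtain ⟨hγ₁P, hγ₁1, hγ₁2⟩ := hγ₁
  obtain ⟨π, hπP, hπ₀, hπ₁⟩ := exists_gluing γ₀ γ₁ (hγ₀2.trans hγ₁1.symm)
  have m₀ : π.map (fun p => p.1.1) = μ₀ := by
    rw [← hγ₀1, ← hπ₀, Measure.map_map measurable_fst measurable_fst]; rfl
  have m₂ : π.map (fun p => p.1.2) = μ := by
    rw [← hγ₀2, ← hπ₀, Measure.map_map measurable_snd measurable_fst]; rfl
  have m₁ : π.map (fun p => p.2) = μ₁ := by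
    rw [← hγ₁2, ← hπ₁, Measure.map_map measurable_snd (by fun_prop)]; rfl
  have a₀ : ∀ᵐ p ∂π, p.1.1 ∈ μ₀.support :=
    ae_of_ae_map (by fun_prop) (by rw [m₀]; exact Measure.support_mem_ae)
  have a₁ : ∀ᵐ p ∂π, p.2 ∈ μ₁.support :=
    ae_of_ae_map (by fun_prop) (by rw [m₁]; exact Measure.support_mem_ae)
  have a₂ : ∀ᵐ p ∂π, p.1.2 ∈ K :=
    ae_of_ae_map (by fun_prop) (by rw [m₂]; exact mem_of_superset Measure.support_mem_ae hμK)
  have hTK : ∀ᵐ p ∂π, T p ∈ K := by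
    filter_upwards [a₂] with p hp
    by_cases hpM : p ∈ M
    · exact (hgain p hpM).1
    · rwa [hrest p hpM]
  have hν : π.map T ∈ probOn K :=
    ⟨Measure.isProbabilityMeasure_map hT.aemeasurable,
      Measure.support_subset_of_isClosed hK.isClosed
        ((ae_map_iff hT.aemeasurable hK.isClosed.measurableSet).2 hTK)⟩
  have hB : MeasurableSet ((fun p : (Euc d × Euc d) × Euc d => p.1.2) ⁻¹' Metric.closedBall z r) :=
    Metric.isClosed_closedBall.measurableSet.preimage (by fun_prop)
  -- Almost every triple with middle point in the ball lies in `M` and gains δ; off `M` nothing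
  -- moves.
  have hpt : ∀ᵐ p ∂π, ENNReal.ofReal (c₀ p.1.1 (T p)) + ENNReal.ofReal (c₁ (T p) p.2) +
      ((fun p : (Euc d × Euc d) × Euc d => p.1.2) ⁻¹' Metric.closedBall z r).indicator
        (fun _ => ENNReal.ofReal δ) p ≤
      ENNReal.ofReal (c₀ p.1.1 p.1.2) + ENNReal.ofReal (c₁ p.1.2 p.2) := by
    filter_upwards [a₀, a₁] with p h0 h1
    by_cases hpM : p ∈ M
    · have hle : c₀ p.1.1 (T p) + c₁ (T p) p.2 + δ ≤ c₀ p.1.1 p.1.2 + c₁ p.1.2 p.2 :=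
        (hgain p hpM).2
      calc _ ≤ ENNReal.ofReal (c₀ p.1.1 (T p)) + ENNReal.ofReal (c₁ (T p) p.2) +
            ENNReal.ofReal δ := by
            gcongr; exact indicator_le_self' (fun _ _ => zero_le) p
        _ ≤ _ := by
          rw [← ENNReal.ofReal_add (hp₀ _ _) (hp₁ _ _),
            ← ENNReal.ofReal_add (add_nonneg (hp₀ _ _) (hp₁ _ _)) hδ.le,
            ← ENNReal.ofReal_add (hp₀ _ _) (hp₁ _ _)]
          exact ENNReal.ofReal_le_ofReal hle
    · have hpB : p ∉ (fun p : (Euc d × Euc d) × Euc d => p.1.2) ⁻¹' Metric.closedBall z r :=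
        fun hpB => hpM (hCM ⟨⟨h0, hpB⟩, h1⟩)
      simp [hpB, hrest p hpM]
  have hmeas₀ : Measurable fun p : (Euc d × Euc d) × Euc d =>
      ENNReal.ofReal (c₀ p.1.1 p.1.2) :=
    (hc₀.comp (f := fun p : (Euc d × Euc d) × Euc d => p.1)
      (by fun_prop)).measurable.ennreal_ofReal
  have hmeasT₀ : Measurable fun p : (Euc d × Euc d) × Euc d => ENNReal.ofReal (c₀ p.1.1 (T p)) :=
    (hc₀.measurable.comp (f := fun p : (Euc d × Euc d) × Euc d => (p.1.1, T p))
      (by fun_prop)).ennreal_ofReal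
  have hmeasT₁ : Measurable fun p : (Euc d × Euc d) × Euc d => ENNReal.ofReal (c₁ (T p) p.2) :=
    (hc₁.measurable.comp (f := fun p : (Euc d × Euc d) × Euc d => (T p, p.2))
      (by fun_prop)).ennreal_ofReal
  have hint := lintegral_mono_ae hpt
  rw [lintegral_add_right _ (measurable_const.indicator hB), lintegral_add_left hmeasT₀,
    lintegral_add_left hmeas₀, lintegral_indicator_const hB,
    ← Measure.map_apply (by fun_prop) Metric.isClosed_closedBall.measurableSet, m₂, ← hη] at hint
  have i₀ : ∫⁻ p, ENNReal.ofReal (c₀ p.1.1 p.1.2) ∂π = ∫⁻ p, ENNReal.ofReal (c₀ p.1 p.2) ∂γ₀ := by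
    rw [← hπ₀]; exact (lintegral_map hc₀.measurable.ennreal_ofReal measurable_fst).symm
  have i₁ : ∫⁻ p, ENNReal.ofReal (c₁ p.1.2 p.2) ∂π = ∫⁻ p, ENNReal.ofReal (c₁ p.1 p.2) ∂γ₁ := by
    rw [← hπ₁]
    exact (lintegral_map (g := fun p : (Euc d × Euc d) × Euc d => (p.1.2, p.2))
      hc₁.measurable.ennreal_ofReal (by fun_prop)).symm
  have t₀ := transportCost_map_le π hc₀ (f := fun p => p.1.1) (g := T) (by fun_prop) hT
  have t₁ := transportCost_map_le π hc₁ (f := T) (g := fun p => p.2) hT (by fun_prop)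
  rw [m₀] at t₀
  rw [m₁] at t₁
  refine lt_irrefl (transportCost c₀ μ₀ μ + transportCost c₁ μ μ₁ + η) ?_
  calc _ ≤ transportCost c₀ μ₀ (π.map T) + transportCost c₁ (π.map T) μ₁ + η := by
        gcongr ?_ + η; exact hopt _ hν
    _ ≤ _ := (add_le_add (add_le_add t₀ t₁) le_rfl).trans hint
    _ < (transportCost c₀ μ₀ μ + η / 2) + (transportCost c₁ μ μ₁ + η / 2) := by
        rw [i₀, i₁]; exact ENNReal.add_lt_add hlt₀ hlt₁
    _ = _ := by rw [add_add_add_comm, ENNReal.add_halves]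

theorem continuous_distCost {d : ℕ} (κ : ℝ) {α : ℝ} (hα : 0 ≤ α) :
    Continuous (Function.uncurry (distCost (d := d) κ α)) := by
  unfold distCost Function.uncurry
  exact continuous_const.mul
    ((continuous_fst.sub continuous_snd).norm.rpow_const fun _ => Or.inr hα)

theorem mainTheorem8 (d : ℕ) (μ₀ μ₁ : Measure (Euc d))
    [IsProbabilityMeasure μ₀] [IsProbabilityMeasure μ₁]
    (hμ₀ : IsCompact μ₀.support) (hμ₁ : IsCompact μ₁.support)
    (K : Set (Euc d)) (hK : IsCompact K)
    (α lam : ℝ) (hlam : 0 < lam)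
    (h : (α = 1 ∧ 1 < lam ∧ Disjoint (interior K) μ₁.support) ∨
      (α ∈ Ioo (0 : ℝ) 1 ∧ Disjoint (interior K) (μ₀.support ∪ μ₁.support)))
    (μ : Measure (Euc d))
    (hμ : IsOptimalPivot (distCost 1 α) (distCost lam α) μ₀ μ₁ (probOn K) μ) :
    μ.support ⊆ frontier K := by
  have hα : 0 < α := by
    rcases h with ⟨rfl, -, -⟩ | ⟨hα, -⟩
    exacts [one_pos, hα.1]
  refine hμ.support_subset_frontier (continuous_distCost 1 hα.le) (continuous_distCost lam hα.le)
    (fun x y => by unfold distCost; positivity) (fun x y => by unfold distCost; positivity)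
    hμ₀ hμ₁ hK fun x₀ hx₀ x hx x₁ hx₁ => ?_
  -- As `K` is a neighbourhood of `x`, minimality over `K` would make `x` a local minimum.
  by_contra! hmin
  have hloc : IsLocalMin (fun y => distCost 1 α x₀ y + distCost lam α y x₁) x := by
    filter_upwards [mem_interior_iff_mem_nhds.1 hx] with y hy using hmin y hy
  rcases h with ⟨rfl, h1, hdisj⟩ | ⟨hα1, hdisj⟩
  · refine not_isLocalMin_dist_add_mul_dist h1 (x₀ := x₀) (x := x) (x₁ := x₁) ?_ ?_
    · rintro rfl
      exact disjoint_left.1 hdisj hx hx₁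
    · simpa [distCost] using hloc
  · refine not_isLocalMin_rpow_dist_add_mul_rpow_dist hlam hα1.1 hα1.2
      (x₀ := x₀) (x := x) (x₁ := x₁) ?_ ?_ ?_
    · rintro rfl
      exact disjoint_left.1 hdisj hx (Or.inl hx₀)
    · rintro rfl
      exact disjoint_left.1 hdisj hx (Or.inr hx₁)
    · simpa [distCost] using hloc
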